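/- Consider finite simple graphs up to isomorphism, the empty graph $0$ being allowed. For graphs $G=(V,E)$ and $H=(W,F)$ let $G+H$ be the Zykov join (the disjoint union of $G$ and $H$ together with all edges between $V$ and $W$), and let $G\cdot H$ be the Zykov product, the graph on $V\times W$ in which $(a,b)$ and $(c,d)$ are adjacent if and only if $(a,c)\in E$ or $(b,d)\in F$. With these operations the isomorphism classes of graphs form a commutative semiring with zero $0$ and unit $1=K_1$. A graph $P\neq 1$ is called prime if the only graphs dividing it with respect to $\cdot$ are $1$ and $P$. A prime factorization of a graph $G$ is a finite multiset (possibly empty) of prime graphs whose product is $G$. 1. Prime factorization of graphs under the Zykov product is not unique: there is a non-empty graph with two different prime factorizations. Explicitly, if $x=P_2$ is the graph with two vertices and no edge, then $$(1+x+x^2)\cdot(1+x^3)=(1+x^2+x^4)\cdot(1+x),$$ the four graphs $1+x+x^2$, $1+x^3$, $1+x^2+x^4$, $1+x$ are all prime, and the multisets $\{1+x+x^2,\,1+x^3\}$ and $\{1+x^2+x^4,\,1+x\}$ are different. 2. Every finite simple graph whose complement is connected has exactly one prime factorization under the Zykov product. -/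

import Mathlib

/-! Finite simple graphs up to isomorphism, with the Zykov join as addition and the Zykov
product as multiplication. -/

/-- The Zykov join of two graphs: the disjoint union, together with all edges between the two. -/
def zykovJoin {V W : Type} (G : SimpleGraph V) (H : SimpleGraph W) : SimpleGraph (V ⊕ W) where
  Adj
    | .inl a, .inl b => G.Adj a b
    | .inr a, .inr b => H.Adj a b
    | _, _ => True
  symm := ⟨by
    rintro (a | a) (b | b) h
    · exact G.adj_symm h
    · trivial
    · trivial
    · exact H.adj_symm h⟩
  loopless := ⟨by
    rintro (a | a) h
    · exact G.loopless.irrefl a h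
    · exact H.loopless.irrefl a h⟩

/-- The Zykov product of two graphs: `(a, b)` and `(c, d)` are adjacent if and only if
`a, c` are adjacent in the first graph or `b, d` are adjacent in the second. -/
def zykovProd {V W : Type} (G : SimpleGraph V) (H : SimpleGraph W) : SimpleGraph (V × W) where
  Adj p q := G.Adj p.1 q.1 ∨ H.Adj p.2 q.2
  symm := ⟨fun _ _ h => h.imp (fun h => G.adj_symm h) (fun h => H.adj_symm h)⟩
  loopless := ⟨fun _ h => h.elim (G.loopless.irrefl _) (H.loopless.irrefl _)⟩

/-- A finite simple graph (the empty graph is allowed). -/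
structure FinGraph where
  V : Type
  [fin : Finite V]
  graph : SimpleGraph V

attribute [instance] FinGraph.fin

/-- Finite simple graphs are identified when they are isomorphic. -/
instance FinGraph.isoSetoid : Setoid FinGraph where
  r A B := Nonempty (A.graph ≃g B.graph)
  iseqv :=
    ⟨fun _ => ⟨SimpleGraph.Iso.refl⟩, fun ⟨e⟩ => ⟨e.symm⟩, fun ⟨e⟩ ⟨f⟩ => ⟨e.trans f⟩⟩

/-- Isomorphism classes of finite simple graphs. -/
def ZykovGraph : Type 1 := Quotient FinGraph.isoSetoid

namespace ZykovGraph

/-- The isomorphism class of a finite simple graph. -/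
def of {V : Type} [Finite V] (G : SimpleGraph V) : ZykovGraph :=
  Quotient.mk FinGraph.isoSetoid ⟨V, G⟩

theorem of_eq_of_iff {V W : Type} [Finite V] [Finite W] (G : SimpleGraph V) (H : SimpleGraph W) :
    of G = of H ↔ Nonempty (G ≃g H) :=
  Quotient.eq (r := FinGraph.isoSetoid)

theorem ind {p : ZykovGraph → Prop}
    (h : ∀ (V : Type) [Finite V] (G : SimpleGraph V), p (of G)) (g : ZykovGraph) : p g :=
  Quotient.inductionOn g fun A => h A.V A.graph

/-- The empty graph. -/
instance : Zero ZykovGraph := ⟨of (⊥ : SimpleGraph Empty)⟩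

/-- The one-point graph. -/
instance : One ZykovGraph := ⟨of (⊥ : SimpleGraph Unit)⟩

/-- Addition is the Zykov join. -/
instance : Add ZykovGraph :=
  ⟨Quotient.map₂ (fun A B => ⟨A.V ⊕ B.V, zykovJoin A.graph B.graph⟩) (by
    rintro A A' ⟨e⟩ B B' ⟨f⟩
    refine ⟨⟨Equiv.sumCongr e.toEquiv f.toEquiv, ?_⟩⟩
    rintro (a | a) (b | b)
    · exact e.map_rel_iff
    · exact Iff.rfl
    · exact Iff.rfl
    · exact f.map_rel_iff)⟩

/-- Multiplication is the Zykov product. -/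
instance : Mul ZykovGraph :=
  ⟨Quotient.map₂ (fun A B => ⟨A.V × B.V, zykovProd A.graph B.graph⟩) (by
    rintro A A' ⟨e⟩ B B' ⟨f⟩
    exact ⟨⟨Equiv.prodCongr e.toEquiv f.toEquiv, or_congr e.map_rel_iff f.map_rel_iff⟩⟩)⟩

theorem of_add_of {V W : Type} [Finite V] [Finite W] (G : SimpleGraph V) (H : SimpleGraph W) :
    of G + of H = of (zykovJoin G H) := rfl

theorem of_mul_of {V W : Type} [Finite V] [Finite W] (G : SimpleGraph V) (H : SimpleGraph W) :
    of G * of H = of (zykovProd G H) := rfl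

theorem zero_def : (0 : ZykovGraph) = of (⊥ : SimpleGraph Empty) := rfl

theorem one_def : (1 : ZykovGraph) = of (⊥ : SimpleGraph Unit) := rfl

theorem add_assoc' (a b c : ZykovGraph) : a + b + c = a + (b + c) := by
  induction a using ind with | h V G
  induction b using ind with | h W H
  induction c using ind with | h U K
  refine (of_eq_of_iff _ _).2 ⟨⟨Equiv.sumAssoc V W U, ?_⟩⟩
  rintro ((a | a) | a) ((b | b) | b) <;> exact Iff.rfl

theorem add_comm' (a b : ZykovGraph) : a + b = b + a := by
  induction a using ind with | h V G
  induction b using ind with | h W H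
  refine (of_eq_of_iff _ _).2 ⟨⟨Equiv.sumComm V W, ?_⟩⟩
  rintro (a | a) (b | b) <;> exact Iff.rfl

theorem zero_add' (a : ZykovGraph) : 0 + a = a := by
  induction a using ind with | h V G
  refine (of_eq_of_iff _ _).2 ⟨⟨Equiv.emptySum Empty V, ?_⟩⟩
  rintro (a | a) (b | b)
  · exact a.elim
  · exact a.elim
  · exact b.elim
  · exact Iff.rfl

theorem mul_assoc' (a b c : ZykovGraph) : a * b * c = a * (b * c) := by
  induction a using ind with | h V G
  induction b using ind with | h W H
  induction c using ind with | h U K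
  exact (of_eq_of_iff _ _).2 ⟨⟨Equiv.prodAssoc V W U, or_assoc.symm⟩⟩

theorem mul_comm' (a b : ZykovGraph) : a * b = b * a := by
  induction a using ind with | h V G
  induction b using ind with | h W H
  exact (of_eq_of_iff _ _).2 ⟨⟨Equiv.prodComm V W, or_comm⟩⟩

theorem one_mul' (a : ZykovGraph) : 1 * a = a := by
  induction a using ind with | h V G
  exact (of_eq_of_iff _ _).2 ⟨⟨Equiv.punitProd V, by simp [zykovProd]⟩⟩

theorem zero_mul' (a : ZykovGraph) : 0 * a = 0 := by
  induction a using ind with | h V G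
  refine (of_eq_of_iff _ _).2 ⟨⟨⟨fun p => p.1, fun e => e.elim, fun p => p.1.elim,
    fun e => e.elim⟩, ?_⟩⟩
  rintro ⟨⟨⟩, _⟩

theorem mul_add' (a b c : ZykovGraph) : a * (b + c) = a * b + a * c := by
  induction a using ind with | h V G
  induction b using ind with | h W H
  induction c using ind with | h U K
  refine (of_eq_of_iff _ _).2 ⟨⟨Equiv.prodSumDistrib V W U, ?_⟩⟩
  rintro ⟨a, b | b⟩ ⟨a', b' | b'⟩
  · exact Iff.rfl
  · exact iff_of_true trivial (Or.inr trivial)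
  · exact iff_of_true trivial (Or.inr trivial)
  · exact Iff.rfl

/-- Isomorphism classes of finite simple graphs form a commutative semiring under the Zykov join
and the Zykov product. -/
instance : CommSemiring ZykovGraph where
  add_assoc := add_assoc'
  add_comm := add_comm'
  zero_add := zero_add'
  add_zero a := by rw [add_comm', zero_add']
  mul_assoc := mul_assoc'
  mul_comm := mul_comm'
  one_mul := one_mul'
  mul_one a := by rw [mul_comm', one_mul']
  zero_mul := zero_mul'
  mul_zero a := by rw [mul_comm', zero_mul']
  left_distrib := mul_add'
  right_distrib a b c := by rw [mul_comm', mul_add', mul_comm' c a, mul_comm' c b]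
  nsmul := nsmulRec

/-- `pointGraph n` is the graph with `n` vertices and no edges. -/
def pointGraph (n : ℕ) : ZykovGraph := of (⊥ : SimpleGraph (Fin n))

/-- A graph other than the one-point graph is (multiplicatively) prime if it is divisible, with
respect to the Zykov product, only by the one-point graph and by itself. The empty graph is not
prime since every graph divides it. -/
def IsPrimeGraph (p : ZykovGraph) : Prop :=
  p ≠ 1 ∧ ∀ d : ZykovGraph, d ∣ p → d = 1 ∨ d = p

/-- The multiset `s` is a prime factorization of `g` under the Zykov product. The multiset may be
empty; its product is then the one-point graph. -/
def IsPrimeFactorization (s : Multiset ZykovGraph) (g : ZykovGraph) : Prop :=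
  (∀ p ∈ s, IsPrimeGraph p) ∧ s.prod = g

end ZykovGraph

/-! Non-uniqueness comes from a missing negative coefficient: `1 + x ^ 3` and `1 + x ^ 2 + x ^ 4`
share the polynomial factor `1 - x + x ^ 2`, which is not a graph. The four factors are complete
multipartite graphs with two or three classes, one of them a singleton, and this makes them prime
(`isPrimeGraph_blow_top`).

Uniqueness rests on the refinement property `exists_refinement`: if `a * b = c * d` has connected
complement, the two factorizations have a common refinement into four factors. This makes primes
behave like prime elements and allows cancellation, and the usual induction applies.

To prove refinement, write each graph as a weighted thin graph, its quotient by twins, with class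
sizes as weights. Under the product the bases multiply and so do the weights. In terms of
complements the product is the strong product, so co-neighbourhoods of a product are boxes and
logarithms of their sizes add. This gives a path metric, intrinsic to the graph, that is the sum of
the metrics of the factors (`pathDist_prod`) and separates points when the graph is thin. Comparing
the sum decompositions of two factorizations shows that each layer of one is a box for the other
(`layer_box`), so the thin bases refine. The weights then refine as well: their primitive parts are
forced, and their gcds refine in `ℕ` (`exists_weight_refinement`). -/

/-! ### A canonical path metric -/

/-- The vertices which are not adjacent to `x`, including `x` itself. -/
def conbhd {V : Type} (G : SimpleGraph V) (x : V) : Set V := {z | ¬ G.Adj x z}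

/-- The complement of `G` is connected, stated through the reflexive relation `¬ G.Adj`. -/
def CoConnected {V : Type} (G : SimpleGraph V) : Prop :=
  Nonempty V ∧ ∀ x y, Relation.ReflTransGen (fun a b => ¬ G.Adj a b) x y

/-- Distinct vertices have distinct neighbourhoods. -/
def Thin {V : Type} (G : SimpleGraph V) : Prop :=
  ∀ x y, (∀ z, G.Adj x z ↔ G.Adj y z) → x = y

/-- The length of a step, measuring how far the co-neighbourhoods of `x` and `y` differ. -/
noncomputable def stepLength {V : Type} (G : SimpleGraph V) (x y : V) : ℝ :=
  Real.log (conbhd G x).ncard + Real.log (conbhd G y).ncard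
    - 2 * Real.log (conbhd G x ∩ conbhd G y).ncard

/-- There is a path of length `r` from `x` to `y` in the complement of `G`. -/
inductive PathLength {V : Type} (G : SimpleGraph V) : V → V → ℝ → Prop
  | refl (x : V) : PathLength G x x 0
  | step {x y z : V} {r : ℝ} :
      ¬ G.Adj x y → PathLength G y z r → PathLength G x z (stepLength G x y + r)

/-- The path distance in the complement of `G`. -/
noncomputable def pathDist {V : Type} (G : SimpleGraph V) (x y : V) : ℝ :=
  sInf {r | PathLength G x y r}

set_option linter.unusedSectionVars false

section Metric

variable {V W : Type} [Finite V] [Finite W] {G : SimpleGraph V} {H : SimpleGraph W}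

theorem mem_conbhd_self (G : SimpleGraph V) (x : V) : x ∈ conbhd G x := G.loopless.irrefl x

theorem conbhd_inter_nonempty {x y : V} (h : ¬ G.Adj x y) :
    (conbhd G x ∩ conbhd G y).Nonempty :=
  ⟨x, mem_conbhd_self G x, fun h' => h h'.symm⟩

theorem conbhd_prod (x y) :
    conbhd (zykovProd G H) (x, y) = conbhd G x ×ˢ conbhd H y := by
  ext ⟨a, b⟩
  simp [conbhd, zykovProd]

theorem log_ncard_prod {s : Set V} {t : Set W} (hs : s.Nonempty) (ht : t.Nonempty) :
    Real.log (s ×ˢ t).ncard = Real.log s.ncard + Real.log t.ncard := by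
  have hs' : s.ncard ≠ 0 := (Set.ncard_pos (Set.toFinite s)).2 hs |>.ne'
  have ht' : t.ncard ≠ 0 := (Set.ncard_pos (Set.toFinite t)).2 ht |>.ne'
  rw [Set.ncard_prod, Nat.cast_mul, Real.log_mul (by exact_mod_cast hs') (by exact_mod_cast ht')]

/-- Co-neighbourhoods and their intersections are boxes, so cardinalities multiply. Non-adjacency
keeps the intersections non-empty, which excludes the junk value `Real.log 0 = 0`. -/
theorem stepLength_prod {p q : V × W} (h : ¬ (zykovProd G H).Adj p q) :
    stepLength (zykovProd G H) p q = stepLength G p.1 q.1 + stepLength H p.2 q.2 := by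
  obtain ⟨a, b⟩ := p
  obtain ⟨c, d⟩ := q
  have h1 : ¬ G.Adj a c := fun h' => h (Or.inl h')
  have h2 : ¬ H.Adj b d := fun h' => h (Or.inr h')
  simp only [stepLength, conbhd_prod, Set.prod_inter_prod]
  rw [log_ncard_prod ⟨a, mem_conbhd_self G a⟩ ⟨b, mem_conbhd_self H b⟩,
    log_ncard_prod ⟨c, mem_conbhd_self G c⟩ ⟨d, mem_conbhd_self H d⟩,
    log_ncard_prod (conbhd_inter_nonempty h1) (conbhd_inter_nonempty h2)]
  ring

theorem stepLength_self (G : SimpleGraph V) (x : V) : stepLength G x x = 0 := by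
  simp only [stepLength, Set.inter_self]
  ring

theorem log_ncard_le {s t : Set V} (hs : s.Nonempty) (hst : s ⊆ t) :
    Real.log s.ncard ≤ Real.log t.ncard :=
  Real.log_le_log (by exact_mod_cast (Set.ncard_pos (Set.toFinite s)).2 hs)
    (by exact_mod_cast Set.ncard_le_ncard hst (Set.toFinite t))

theorem eq_of_log_ncard_le {s t : Set V} (hs : s.Nonempty) (hst : s ⊆ t)
    (h : Real.log t.ncard ≤ Real.log s.ncard) : s = t := by
  refine Set.eq_of_subset_of_ncard_le hst ?_ (Set.toFinite t)
  have h1 : 0 < s.ncard := (Set.ncard_pos (Set.toFinite s)).2 hs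
  have h2 : 0 < t.ncard := (Set.ncard_pos (Set.toFinite t)).2 (hs.mono hst)
  exact_mod_cast (Real.log_le_log_iff (by exact_mod_cast h2) (by exact_mod_cast h1)).1 h

theorem stepLength_nonneg {x y : V} (h : ¬ G.Adj x y) : 0 ≤ stepLength G x y := by
  have h1 := log_ncard_le (conbhd_inter_nonempty h) Set.inter_subset_left
  have h2 := log_ncard_le (conbhd_inter_nonempty h) Set.inter_subset_right
  simp only [stepLength]
  linarith

/-- Length zero forces both co-neighbourhoods to equal their intersection, so `x` and `y` are twins.
-/
theorem stepLength_pos (hG : Thin G) {x y : V} (h : ¬ G.Adj x y) (hne : x ≠ y) :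
    0 < stepLength G x y := by
  refine (stepLength_nonneg h).lt_of_ne fun h0 => hne (hG x y fun z => ?_)
  have hn := conbhd_inter_nonempty h
  have h1 := log_ncard_le hn Set.inter_subset_left
  have h2 := log_ncard_le hn Set.inter_subset_right
  simp only [stepLength] at h0
  have e1 := eq_of_log_ncard_le hn Set.inter_subset_left (by linarith)
  have e2 := eq_of_log_ncard_le hn Set.inter_subset_right (by linarith)
  have := Set.ext_iff.1 (e1.symm.trans e2) z
  exact not_iff_not.1 this

theorem PathLength.nonneg {x y : V} {r : ℝ} (h : PathLength G x y r) : 0 ≤ r := by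
  induction h with
  | refl x => exact le_rfl
  | step h _ ih => exact add_nonneg (stepLength_nonneg h) ih

theorem PathLength.trans {x y z : V} {r s : ℝ} (h : PathLength G x y r)
    (h' : PathLength G y z s) : PathLength G x z (r + s) := by
  induction h with
  | refl x => simpa using h'
  | step h _ ih => rw [add_assoc]; exact .step h (ih h')

theorem CoConnected.exists_pathLength (hG : CoConnected G) (x y : V) :
    ∃ r, PathLength G x y r := by
  induction hG.2 x y using Relation.ReflTransGen.head_induction_on with
  | refl => exact ⟨0, .refl _⟩
  | head h _ ih => exact ⟨_, .step h ih.choose_spec⟩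

theorem CoConnected.map (hG : CoConnected G) (f : V → W) (hf : Function.Surjective f)
    (h : ∀ x y, ¬ G.Adj x y → ¬ H.Adj (f x) (f y)) : CoConnected H := by
  refine ⟨hG.1.map f, fun x y => ?_⟩
  obtain ⟨x, rfl⟩ := hf x
  obtain ⟨y, rfl⟩ := hf y
  exact (hG.2 x y).lift f h

theorem PathLength.pathDist_le {x y : V} {r : ℝ} (h : PathLength G x y r) :
    pathDist G x y ≤ r :=
  csInf_le ⟨0, fun _ h => PathLength.nonneg h⟩ h

/-- Co-connectedness makes the set of path lengths non-empty; otherwise `sInf ∅ = 0` would break the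
bound for positive `c`. -/
theorem CoConnected.le_pathDist (hG : CoConnected G) {x y : V} {c : ℝ}
    (h : ∀ r, PathLength G x y r → c ≤ r) : c ≤ pathDist G x y :=
  le_csInf (hG.exists_pathLength x y) h

theorem CoConnected.pathDist_nonneg (hG : CoConnected G) (x y : V) : 0 ≤ pathDist G x y :=
  hG.le_pathDist fun _ h => h.nonneg

theorem pathDist_self (hG : CoConnected G) (x : V) : pathDist G x x = 0 :=
  le_antisymm (PathLength.refl x).pathDist_le (hG.pathDist_nonneg x x)

theorem CoConnected.pathDist_triangle (hG : CoConnected G) (x y z : V) :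
    pathDist G x z ≤ pathDist G x y + pathDist G y z := by
  rw [← sub_le_iff_le_add]
  refine hG.le_pathDist fun r hr => ?_
  rw [sub_le_comm]
  refine hG.le_pathDist fun s hs => ?_
  linarith [(hr.trans hs).pathDist_le]

/-- By finiteness the steps between distinct vertices have a positive minimal length `ε`, and a path
between distinct vertices contains such a step. -/
theorem Thin.eq_of_pathDist_le_zero (hG : Thin G) (hc : CoConnected G) {x y : V}
    (h : pathDist G x y ≤ 0) : x = y := by
  by_contra hne
  have key : ∃ ε > 0, ∀ u v, ¬ G.Adj u v → u ≠ v → ε ≤ stepLength G u v := by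
    have hfin : {p : V × V | ¬ G.Adj p.1 p.2 ∧ p.1 ≠ p.2}.Finite := Set.toFinite _
    by_cases hn : {p : V × V | ¬ G.Adj p.1 p.2 ∧ p.1 ≠ p.2}.Nonempty
    · obtain ⟨p, hp, hmin⟩ := hfin.exists_minimalFor (fun p => stepLength G p.1 p.2) _ hn
      refine ⟨_, stepLength_pos hG hp.1 hp.2, fun u v h1 h2 => ?_⟩
      exact (le_total _ _).elim id fun h => hmin (j := (u, v)) ⟨h1, h2⟩ h
    · exact ⟨1, one_pos, fun u v h1 h2 => (hn ⟨(u, v), h1, h2⟩).elim⟩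
  obtain ⟨ε, hε, hstep⟩ := key
  have : ∀ {x y r}, PathLength G x y r → x ≠ y → ε ≤ r := by
    intro x y r hr
    induction hr with
    | refl x => exact fun h => (h rfl).elim
    | @step x y z r h h' ih =>
      intro hxz
      by_cases hxy : x = y
      · subst hxy
        linarith [ih hxz, stepLength_nonneg h]
      · linarith [hstep x y h hxy, h'.nonneg]
  linarith [hc.le_pathDist fun r hr => this hr hne]

theorem PathLength.fst_snd {p q : V × W} {r : ℝ} (h : PathLength (zykovProd G H) p q r) :
    ∃ s t, PathLength G p.1 q.1 s ∧ PathLength H p.2 q.2 t ∧ r = s + t := by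
  induction h with
  | refl x => exact ⟨0, 0, .refl _, .refl _, by simp⟩
  | step h _ ih =>
    obtain ⟨s, t, hs, ht, rfl⟩ := ih
    refine ⟨_, _, .step (fun h' => h (Or.inl h')) hs, .step (fun h' => h (Or.inr h')) ht, ?_⟩
    rw [stepLength_prod h]
    ring

/-- Keeping one coordinate fixed is allowed since non-adjacency is reflexive, and it costs nothing.
-/
theorem PathLength.prod_left {x y : V} {r : ℝ} (h : PathLength G x y r) (b : W) :
    PathLength (zykovProd G H) (x, b) (y, b) r := by
  induction h with
  | refl x => exact .refl _
  | @step x y z r h _ ih =>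
    have h' : ¬ (zykovProd G H).Adj (x, b) (y, b) := fun h' => h'.elim h (H.loopless.irrefl b)
    have := PathLength.step h' ih
    rwa [stepLength_prod h', stepLength_self, add_zero] at this

theorem PathLength.prod_right {x y : W} {r : ℝ} (h : PathLength H x y r) (a : V) :
    PathLength (zykovProd G H) (a, x) (a, y) r := by
  induction h with
  | refl x => exact .refl _
  | @step x y z r h _ ih =>
    have h' : ¬ (zykovProd G H).Adj (a, x) (a, y) := fun h' => h'.elim (G.loopless.irrefl a) h
    have := PathLength.step h' ih
    rwa [stepLength_prod h', stepLength_self, zero_add] at this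

theorem CoConnected.fst (h : CoConnected (zykovProd G H)) : CoConnected G :=
  have : Nonempty W := h.1.map Prod.snd
  h.map Prod.fst Prod.fst_surjective fun _ _ h h' => h (Or.inl h')

theorem CoConnected.snd (h : CoConnected (zykovProd G H)) : CoConnected H :=
  have : Nonempty V := h.1.map Prod.fst
  h.map Prod.snd Prod.snd_surjective fun _ _ h h' => h (Or.inr h')

/-- Moving in one coordinate at a time gives `≤`; projecting a path to both factors gives `≥`. -/
theorem pathDist_prod (h : CoConnected (zykovProd G H)) (p q : V × W) :
    pathDist (zykovProd G H) p q = pathDist G p.1 q.1 + pathDist H p.2 q.2 := by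
  apply le_antisymm
  · rw [← sub_le_iff_le_add]
    refine h.fst.le_pathDist fun r hr => ?_
    rw [sub_le_comm]
    refine h.snd.le_pathDist fun s hs => ?_
    linarith [((hr.prod_left p.2).trans (hs.prod_right q.1)).pathDist_le]
  · refine h.le_pathDist fun r hr => ?_
    obtain ⟨s, t, hs, ht, rfl⟩ := hr.fst_snd
    exact add_le_add hs.pathDist_le ht.pathDist_le

theorem conbhd_iso (e : G ≃g H) (x : V) : conbhd H (e x) = e '' conbhd G x := by
  ext z
  obtain ⟨z, rfl⟩ := e.surjective z
  rw [e.injective.mem_set_image]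
  exact not_congr e.map_rel_iff

theorem stepLength_iso (e : G ≃g H) (x y : V) :
    stepLength H (e x) (e y) = stepLength G x y := by
  simp only [stepLength, conbhd_iso, ← Set.image_inter e.injective,
    Set.ncard_image_of_injective _ e.injective]

theorem PathLength.iso (e : G ≃g H) {x y : V} {r : ℝ} (h : PathLength G x y r) :
    PathLength H (e x) (e y) r := by
  induction h with
  | refl x => exact .refl _
  | @step x y z r h _ ih =>
    rw [← stepLength_iso e]
    exact .step (fun h' => h (e.map_rel_iff.1 h')) ih

theorem pathDist_iso (e : G ≃g H) (x y : V) : pathDist H (e x) (e y) = pathDist G x y := by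
  unfold pathDist
  congr 1
  ext r
  exact ⟨fun h => by simpa using PathLength.iso e.symm h, fun h => PathLength.iso e h⟩

end Metric

/-! ### Layers of one factorization inside another -/

section Refinement

variable {Q A B C D : Type} [Finite Q] [Finite A] [Finite B] [Finite C] [Finite D]
  {T : SimpleGraph Q} {GA : SimpleGraph A} {GB : SimpleGraph B} {GC : SimpleGraph C}
  {GD : SimpleGraph D}

/-- A layer of one factorization is a box with respect to any other factorization. -/
theorem layer_box (hT : CoConnected T) (hB : Thin GB)
    (α : T ≃g zykovProd GA GB) (γ : T ≃g zykovProd GC GD) {q q' p : Q}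
    (hq : (α q).2 = (α q').2) (h1 : (γ p).1 = (γ q).1) (h2 : (γ p).2 = (γ q').2) :
    (α p).2 = (α q).2 := by
  have hα : CoConnected (zykovProd GA GB) :=
    hT.map α α.surjective fun _ _ h h' => h (α.map_rel_iff.1 h')
  have hγ : CoConnected (zykovProd GC GD) :=
    hT.map γ γ.surjective fun _ _ h h' => h (γ.map_rel_iff.1 h')
  have eα : ∀ x y, pathDist T x y = _ := fun x y =>
    (pathDist_iso α x y).symm.trans (pathDist_prod hα _ _)
  have eγ : ∀ x y, pathDist T x y = _ := fun x y =>
    (pathDist_iso γ x y).symm.trans (pathDist_prod hγ _ _)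
  have a1 := eα q p
  have a2 := eα p q'
  have a3 := eα q q'
  have c1 := eγ q p
  have c2 := eγ p q'
  have c3 := eγ q q'
  rw [h1, pathDist_self hγ.fst] at c1
  rw [h2, pathDist_self hγ.snd, h1] at c2
  rw [h2] at c1
  rw [← hq, pathDist_self hα.snd] at a3
  rw [← hq] at a2
  -- By the `γ`-coordinates, `p` lies metrically between `q` and `q'`. In the `α`-coordinates the
  -- `GA`-distances already account for all of `pathDist T q q'`, so the triangle inequality leaves
  -- no room for a positive `GB`-distance.
  have t := hα.fst.pathDist_triangle (α q).1 (α p).1 (α q').1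
  have n1 := hα.snd.pathDist_nonneg (α q).2 (α p).2
  exact hB.eq_of_pathDist_le_zero hα.snd (by linarith)

/-- A layer of one factorization is the product of its intersections with the layers of
another factorization. -/
theorem exists_layer_iso (hT : CoConnected T) (hB : Thin GB)
    (α : T ≃g zykovProd GA GB) (γ : T ≃g zykovProd GC GD) (q₀ : Q) (W X : Set Q)
    (hW : ∀ q, q ∈ W ↔ (α q).2 = (α q₀).2 ∧ (γ q).2 = (γ q₀).2)
    (hX : ∀ q, q ∈ X ↔ (α q).2 = (α q₀).2 ∧ (γ q).1 = (γ q₀).1) :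
    ∃ Φ : zykovProd (T.induce W) (T.induce X) ≃g GA, ∀ (w : W) (x : X),
      γ (α.symm (Φ (w, x), (α q₀).2)) = ((γ w).1, (γ x).2) := by
  have hαs : ∀ a, α (α.symm (a, (α q₀).2)) = (a, (α q₀).2) := fun a => α.apply_symm_apply _
  have box : ∀ {q q' p : Q}, (α q).2 = (α q₀).2 → (α q').2 = (α q₀).2 →
      (γ p).1 = (γ q).1 → (γ p).2 = (γ q').2 → (α p).2 = (α q₀).2 := fun hq hq' h1 h2 =>
    (layer_box hT hB α γ (hq.trans hq'.symm) h1 h2).trans hq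
  have recover : ∀ {q}, (α q).2 = (α q₀).2 → α.symm ((α q).1, (α q₀).2) = q := by
    intro q h
    rw [← h]
    exact α.symm_apply_apply q
  -- The corner with the first `γ`-coordinate of `w` and the second of `x`; `box` keeps it in the
  -- `α`-layer of `q₀`.
  let mk : W → X → Q := fun w x => γ.symm ((γ w).1, (γ x).2)
  have hmk : ∀ w x, γ (mk w x) = ((γ w).1, (γ x).2) := fun w x => γ.apply_symm_apply _
  have hmk2 : ∀ w x, (α (mk w x)).2 = (α q₀).2 := fun w x =>
    box ((hW w).1 w.2).1 ((hX x).1 x.2).1 (by rw [hmk]) (by rw [hmk])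
  let toW : A → W := fun a => ⟨γ.symm ((γ (α.symm (a, (α q₀).2))).1, (γ q₀).2), by
    have h : γ (γ.symm ((γ (α.symm (a, (α q₀).2))).1, (γ q₀).2)) = _ := γ.apply_symm_apply _
    refine (hW _).2 ⟨box (q := α.symm (a, (α q₀).2)) (q' := q₀) (by rw [hαs]) rfl
      (by rw [h]) (by rw [h]), by rw [h]⟩⟩
  let toX : A → X := fun a => ⟨γ.symm ((γ q₀).1, (γ (α.symm (a, (α q₀).2))).2), by
    have h : γ (γ.symm ((γ q₀).1, (γ (α.symm (a, (α q₀).2))).2)) = _ := γ.apply_symm_apply _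
    refine (hX _).2 ⟨box (q := q₀) (q' := α.symm (a, (α q₀).2)) rfl (by rw [hαs])
      (by rw [h]) (by rw [h]), by rw [h]⟩⟩
  refine ⟨⟨⟨fun p => (α (mk p.1 p.2)).1, fun a => (toW a, toX a), ?_, ?_⟩, ?_⟩, ?_⟩
  · rintro ⟨w, x⟩
    have hw := (hW w).1 w.2
    have hx := (hX x).1 x.2
    refine Prod.ext (Subtype.ext ?_) (Subtype.ext ?_)
    · change γ.symm ((γ (α.symm ((α (mk w x)).1, (α q₀).2))).1, (γ q₀).2) = w
      rw [recover (hmk2 w x), hmk, ← hw.2]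
      exact γ.symm_apply_apply _
    · change γ.symm ((γ q₀).1, (γ (α.symm ((α (mk w x)).1, (α q₀).2))).2) = x
      rw [recover (hmk2 w x), hmk, ← hx.2]
      exact γ.symm_apply_apply _
  · intro a
    have h1 : γ (toW a) = ((γ (α.symm (a, (α q₀).2))).1, (γ q₀).2) := γ.apply_symm_apply _
    have h2 : γ (toX a) = ((γ q₀).1, (γ (α.symm (a, (α q₀).2))).2) := γ.apply_symm_apply _
    have h3 : mk (toW a) (toX a) = α.symm (a, (α q₀).2) := by
      change γ.symm ((γ (toW a)).1, (γ (toX a)).2) = _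
      rw [h1, h2]
      exact γ.symm_apply_apply _
    change (α (mk (toW a) (toX a))).1 = a
    rw [h3, hαs]
  · rintro ⟨w, x⟩ ⟨w', x'⟩
    have hw := ((hW w).1 w.2).2.trans ((hW w').1 w'.2).2.symm
    have hx := ((hX x).1 x.2).2.trans ((hX x').1 x'.2).2.symm
    have e1 : GA.Adj (α (mk w x)).1 (α (mk w' x')).1 ↔ T.Adj (mk w x) (mk w' x') := by
      rw [← α.map_rel_iff]
      change _ ↔ GA.Adj _ _ ∨ GB.Adj _ _
      rw [hmk2, hmk2]
      exact (or_iff_left (GB.loopless.irrefl _)).symm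
    have e2 : T.Adj (mk w x) (mk w' x') ↔ GC.Adj (γ w).1 (γ w').1 ∨ GD.Adj (γ x).2 (γ x').2 := by
      rw [← γ.map_rel_iff, hmk, hmk]
      exact Iff.rfl
    have e3 : T.Adj w w' ↔ GC.Adj (γ w).1 (γ w').1 := by
      rw [← γ.map_rel_iff]
      change GC.Adj _ _ ∨ GD.Adj _ _ ↔ _
      rw [hw]
      exact or_iff_left (GD.loopless.irrefl _)
    have e4 : T.Adj x x' ↔ GD.Adj (γ x).2 (γ x').2 := by
      rw [← γ.map_rel_iff]
      change GC.Adj _ _ ∨ GD.Adj _ _ ↔ _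
      rw [hx]
      exact or_iff_right (GC.loopless.irrefl _)
    change GA.Adj (α (mk w x)).1 (α (mk w' x')).1 ↔ T.Adj w w' ∨ T.Adj x x'
    rw [e1, e2, e3, e4]
  · intro w x
    change γ (α.symm ((α (mk w x)).1, (α q₀).2)) = _
    rw [recover (hmk2 w x), hmk]

end Refinement

/-! ### Refinement of products of natural numbers and of weights -/

theorem Nat.exists_refinement {a b c d : ℕ} (ha : a ≠ 0) (h : a * b = c * d) :
    ∃ w x y z, a = w * x ∧ b = y * z ∧ c = w * y ∧ d = x * z := by
  obtain ⟨w, x, ⟨y, rfl⟩, ⟨z, rfl⟩, rfl⟩ :=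
    exists_dvd_and_dvd_of_dvd_mul (Dvd.intro b h : a ∣ c * d)
  refine ⟨w, x, y, z, rfl, ?_, rfl, rfl⟩
  refine Nat.eq_of_mul_eq_mul_left (Nat.pos_of_ne_zero ha) (h.trans ?_)
  ring

section Weights

open Finset

variable {V W X : Type} [Fintype V] [Fintype W] [Fintype X]

theorem gcd_const_mul (f : V → ℕ) (n : ℕ) : univ.gcd (fun v => n * f v) = n * univ.gcd f := by
  rw [Finset.gcd_mul_left, normalize_eq]

theorem gcd_mul_const (f : V → ℕ) (n : ℕ) : univ.gcd (fun v => f v * n) = univ.gcd f * n := by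
  rw [Finset.gcd_mul_right, normalize_eq]

theorem gcd_mul_prod (f : V → ℕ) (g : W → ℕ) :
    univ.gcd (fun p : V × W => f p.1 * g p.2) = univ.gcd f * univ.gcd g := by
  apply dvd_antisymm
  · rw [← gcd_mul_const]
    refine dvd_gcd fun v _ => ?_
    rw [← gcd_const_mul]
    exact dvd_gcd fun w _ => gcd_dvd (f := fun p : V × W => f p.1 * g p.2) (mem_univ (v, w))
  · exact dvd_gcd fun p _ => mul_dvd_mul (gcd_dvd (mem_univ _)) (gcd_dvd (mem_univ _))

theorem gcd_comp_equiv (e : V ≃ W) (g : W → ℕ) : univ.gcd (fun v => g (e v)) = univ.gcd g := by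
  apply dvd_antisymm
  · refine dvd_gcd fun w _ => ?_
    have := gcd_dvd (f := fun v => g (e v)) (mem_univ (e.symm w))
    rwa [e.apply_symm_apply] at this
  · exact dvd_gcd fun v _ => gcd_dvd (mem_univ _)

/-- Taking gcds of both sides gives `univ.gcd f * k = m * n`, since gcds of product weights
multiply; then `k` cancels. -/
theorem eq_gcd_mul_of_mul_eq {k m n : ℕ} (hk : k ≠ 0) {u : W → ℕ} {v : X → ℕ}
    (hu : univ.gcd u = 1) (hv : univ.gcd v = 1) (e : W × X ≃ V) (f : V → ℕ)
    (h : ∀ w x, f (e (w, x)) * k = (m * u w) * (n * v x)) (w : W) (x : X) :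
    f (e (w, x)) = univ.gcd f * (u w * v x) := by
  have h1 : univ.gcd f * k = m * n := by
    rw [← gcd_comp_equiv e, ← gcd_mul_const]
    have : (fun p : W × X => f (e p) * k) = fun p => (m * n) * (u p.1 * v p.2) := by
      funext p
      rw [h p.1 p.2]
      ring
    rw [this, gcd_const_mul, gcd_mul_prod u v, hu, hv, mul_one, mul_one]
  refine Nat.eq_of_mul_eq_mul_right (Nat.pos_of_ne_zero hk) ?_
  rw [h]
  calc m * u w * (n * v x) = m * n * (u w * v x) := by ring
    _ = univ.gcd f * (u w * v x) * k := by rw [← h1]; ring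

end Weights

section WeightRefinement

open Finset

/-- Up to a constant factor, each of the four weights is a product of two of `FW`, `FX`, `FY`, `FZ`.
Their primitive parts therefore determine everything except the four gcds. -/
theorem exists_weight_refinement {A B C D W X Y Z : Type} [Finite A] [Finite B] [Finite C]
    [Finite D] [Nonempty W] [Nonempty X] [Nonempty Y] [Nonempty Z] [Nonempty A]
    {fA : A → ℕ} {fB : B → ℕ} {fC : C → ℕ} {fD : D → ℕ} (hA : ∀ a, fA a ≠ 0)
    (e : A × B ≃ C × D) (he : ∀ p, fA p.1 * fB p.2 = fC (e p).1 * fD (e p).2)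
    (eA : W × X ≃ A) (eB : Y × Z ≃ B) (eC : W × Y ≃ C) (eD : X × Z ≃ D)
    {FW : W → ℕ} {FX : X → ℕ} {FY : Y → ℕ} {FZ : Z → ℕ} {kA kB kC kD : ℕ}
    (kA0 : kA ≠ 0) (kB0 : kB ≠ 0) (kC0 : kC ≠ 0) (kD0 : kD ≠ 0)
    (h1 : ∀ w x, fA (eA (w, x)) * kA = FW w * FX x)
    (h2 : ∀ y z, fB (eB (y, z)) * kB = FY y * FZ z)
    (h3 : ∀ w y, fC (eC (w, y)) * kC = FW w * FY y)
    (h4 : ∀ x z, fD (eD (x, z)) * kD = FX x * FZ z) :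
    ∃ (gW : W → ℕ) (gX : X → ℕ) (gY : Y → ℕ) (gZ : Z → ℕ),
      (∀ w x, fA (eA (w, x)) = gW w * gX x) ∧ (∀ y z, fB (eB (y, z)) = gY y * gZ z) ∧
      (∀ w y, fC (eC (w, y)) = gW w * gY y) ∧ (∀ x z, fD (eD (x, z)) = gX x * gZ z) := by
  cases nonempty_fintype A
  cases nonempty_fintype B
  cases nonempty_fintype C
  cases nonempty_fintype D
  have : Finite (W × X) := .of_equiv _ eA.symm
  have : Finite (Y × Z) := .of_equiv _ eB.symm
  have : Finite W := .of_surjective (Prod.fst : W × X → W) Prod.fst_surjective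
  have : Finite X := .of_surjective (Prod.snd : W × X → X) Prod.snd_surjective
  have : Finite Y := .of_surjective (Prod.fst : Y × Z → Y) Prod.fst_surjective
  have : Finite Z := .of_surjective (Prod.snd : Y × Z → Z) Prod.snd_surjective
  cases nonempty_fintype W
  cases nonempty_fintype X
  cases nonempty_fintype Y
  cases nonempty_fintype Z
  obtain ⟨uW, hW, hW1⟩ := extract_gcd FW univ_nonempty
  obtain ⟨uX, hX, hX1⟩ := extract_gcd FX univ_nonempty
  obtain ⟨uY, hY, hY1⟩ := extract_gcd FY univ_nonempty
  obtain ⟨uZ, hZ, hZ1⟩ := extract_gcd FZ univ_nonempty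
  replace hW := fun w => hW w (mem_univ w)
  replace hX := fun w => hX w (mem_univ w)
  replace hY := fun w => hY w (mem_univ w)
  replace hZ := fun w => hZ w (mem_univ w)
  have hgcd : univ.gcd fA * univ.gcd fB = univ.gcd fC * univ.gcd fD := by
    rw [← gcd_mul_prod, ← gcd_mul_prod, ← gcd_comp_equiv e]
    exact congrArg _ (funext he)
  have hA0 : univ.gcd fA ≠ 0 :=
    gcd_ne_zero_iff.2 ⟨Classical.arbitrary A, mem_univ _, hA _⟩
  -- The gcds satisfy the same product equation, so they refine in `ℕ`; the resulting numbers
  -- rescale the primitive parts.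
  obtain ⟨w, x, y, z, ha, hb, hc, hd⟩ := Nat.exists_refinement hA0 hgcd
  refine ⟨fun i => w * uW i, fun i => x * uX i, fun i => y * uY i, fun i => z * uZ i,
    fun i j => ?_, fun i j => ?_, fun i j => ?_, fun i j => ?_⟩
  · rw [eq_gcd_mul_of_mul_eq kA0 hW1 hX1 eA fA (fun i j => by rw [h1, ← hW, ← hX]), ha]
    ring
  · rw [eq_gcd_mul_of_mul_eq kB0 hY1 hZ1 eB fB (fun i j => by rw [h2, ← hY, ← hZ]), hb]
    ring
  · rw [eq_gcd_mul_of_mul_eq kC0 hW1 hY1 eC fC (fun i j => by rw [h3, ← hW, ← hY]), hc]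
    ring
  · rw [eq_gcd_mul_of_mul_eq kD0 hX1 hZ1 eD fD (fun i j => by rw [h4, ← hX, ← hZ]), hd]
    ring

end WeightRefinement

/-! ### Blow-ups of thin graphs -/

namespace ZykovGraph

section Blow

variable {V V' Q Q' : Type} [Finite V] [Finite V'] [Finite Q] [Finite Q']
  {T : SimpleGraph Q} {T' : SimpleGraph Q'}

/-- The graph obtained from `T` by replacing each vertex `q` with `f q` twins. -/
def blow (T : SimpleGraph Q) (f : Q → ℕ) : ZykovGraph :=
  of (T.comap (Sigma.fst : (Σ q, Fin (f q)) → Q))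

theorem of_comap_eq_of_comap (e : T ≃g T') (π : V → Q) (π' : V' → Q')
    (h : ∀ q, Nat.card {v // π v = q} = Nat.card {v // π' v = e q}) :
    of (T.comap π) = of (T'.comap π') := by
  have h' : ∀ c, Nonempty ({v // e (π v) = c} ≃ {v // π' v = c}) := by
    intro c
    obtain ⟨q, rfl⟩ := e.surjective c
    have := Finite.card_eq.1 (h q)
    simpa only [e.injective.eq_iff] using this
  let φ := fun c => (h' c).some
  refine (of_eq_of_iff _ _).2 ⟨⟨Equiv.ofFiberEquiv φ, ?_⟩⟩
  intro a b
  simp only [SimpleGraph.comap_adj, Equiv.ofFiberEquiv_map]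
  exact e.map_rel_iff

theorem card_fiber_sigma (f : Q → ℕ) (q : Q) :
    Nat.card {p : Σ q, Fin (f q) // p.1 = q} = f q := by
  rw [Nat.card_congr (Equiv.sigmaSubtype q), Nat.card_fin]

theorem of_comap_eq_blow (T : SimpleGraph Q) (π : V → Q) :
    of (T.comap π) = blow T fun q => Nat.card {v // π v = q} :=
  of_comap_eq_of_comap SimpleGraph.Iso.refl _ _ fun q =>
    (card_fiber_sigma (fun q => Nat.card {v // π v = q}) q).symm

theorem blow_congr (e : T ≃g T') {f : Q → ℕ} {f' : Q' → ℕ} (h : ∀ q, f q = f' (e q)) :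
    blow T f = blow T' f' :=
  of_comap_eq_of_comap e _ _ fun q => by rw [card_fiber_sigma, card_fiber_sigma, h]

theorem blow_mul_blow (f : Q → ℕ) (f' : Q' → ℕ) :
    blow T f * blow T' f' = blow (zykovProd T T') fun p => f p.1 * f' p.2 := by
  refine of_comap_eq_of_comap (T := zykovProd T T') SimpleGraph.Iso.refl
    (fun p : (Σ q, Fin (f q)) × (Σ q, Fin (f' q)) => (p.1.1, p.2.1)) Sigma.fst fun q => ?_
  obtain ⟨a, b⟩ := q
  change _ = Nat.card {p : Σ q : Q × Q', Fin (f q.1 * f' q.2) // p.1 = (a, b)}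
  rw [card_fiber_sigma (fun q : Q × Q' => f q.1 * f' q.2), ← card_fiber_sigma f a,
    ← card_fiber_sigma f' b, ← Nat.card_prod]
  exact Nat.card_congr
    ⟨fun p => (⟨p.1.1, congrArg Prod.fst p.2⟩, ⟨p.1.2, congrArg Prod.snd p.2⟩),
      fun p => ⟨(p.1.1, p.2.1), Prod.ext p.1.2 p.2.2⟩, fun _ => rfl, fun _ => rfl⟩

/-- Vertices are twins if they have the same neighbours. -/
def twinSetoid (G : SimpleGraph V) : Setoid V where
  r x y := ∀ z, G.Adj x z ↔ G.Adj y z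
  iseqv := ⟨fun _ _ => Iff.rfl, fun h z => (h z).symm, fun h h' z => (h z).trans (h' z)⟩

/-- The base is the quotient by twins and the weights are the class sizes. Classes with equal
neighbourhoods have twin representatives, so the quotient is thin. -/
theorem exists_eq_blow (g : ZykovGraph) :
    ∃ (Q : Type) (_ : Finite Q) (T : SimpleGraph Q) (f : Q → ℕ),
      Thin T ∧ (∀ q, f q ≠ 0) ∧ g = blow T f := by
  induction g using ind with | h V G
  let T : SimpleGraph (Quotient (twinSetoid G)) :=
    { Adj := Quotient.lift₂ G.Adj fun a b a' b' h h' => propext <|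
        (h b).trans <| (G.adj_comm _ _).trans <| (h' a').trans (G.adj_comm _ _)
      symm := ⟨fun a b => Quotient.inductionOn₂ a b fun _ _ h => G.adj_symm h⟩
      loopless := ⟨fun a => Quotient.inductionOn a fun a => G.loopless.irrefl a⟩ }
  refine ⟨Quotient (twinSetoid G), inferInstance, T, _, fun a b => ?_, fun q => ?_,
    of_comap_eq_blow T (Quotient.mk _)⟩
  · refine Quotient.inductionOn₂ a b fun a b h => Quotient.sound fun z => h (Quotient.mk _ z)
  · obtain ⟨v, rfl⟩ := Quotient.exists_rep q
    have : Nonempty {w // Quotient.mk (twinSetoid G) w = Quotient.mk _ v} := ⟨v, rfl⟩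
    exact Nat.card_pos.ne'

/-- Over a thin base with non-zero weights, two vertices lie in the same fibre exactly when they are
twins, so an isomorphism of blow-ups carries fibres to fibres. -/
theorem exists_iso_of_blow_eq (hT : Thin T) (hT' : Thin T') {f : Q → ℕ} {f' : Q' → ℕ}
    (hf : ∀ q, f q ≠ 0) (hf' : ∀ q, f' q ≠ 0) (h : blow T f = blow T' f') :
    ∃ e : T ≃g T', ∀ q, f q = f' (e q) := by
  obtain ⟨φ⟩ := (of_eq_of_iff _ _).1 h
  have hφ : ∀ x y, T'.Adj (φ x).1 (φ y).1 ↔ T.Adj x.1 y.1 := fun x y => φ.map_rel_iff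
  let s : ∀ q, Fin (f q) := fun q => ⟨0, Nat.pos_of_ne_zero (hf q)⟩
  let s' : ∀ q, Fin (f' q) := fun q => ⟨0, Nat.pos_of_ne_zero (hf' q)⟩
  have key : ∀ x y, (φ x).1 = (φ y).1 ↔ x.1 = y.1 := by
    intro x y
    constructor
    · intro h
      refine hT _ _ fun z => ?_
      rw [← hφ x ⟨z, s z⟩, ← hφ y ⟨z, s z⟩, h]
    · intro h
      refine hT' _ _ fun z => ?_
      obtain ⟨w, hw⟩ := φ.surjective ⟨z, s' z⟩
      have e1 := hφ x w
      have e2 := hφ y w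
      rw [hw] at e1 e2
      rw [e1, e2, h]
  have key' : ∀ x y, (φ.symm x).1 = (φ.symm y).1 ↔ x.1 = y.1 := fun x y => by
    rw [← key, φ.apply_symm_apply, φ.apply_symm_apply]
  refine ⟨⟨⟨fun q => (φ ⟨q, s q⟩).1, fun q => (φ.symm ⟨q, s' q⟩).1, fun q => ?_, fun q => ?_⟩,
    fun {a b} => hφ _ _⟩, fun q => ?_⟩
  · have := (key' ⟨(φ ⟨q, s q⟩).1, s' _⟩ (φ ⟨q, s q⟩)).2 rfl
    rwa [φ.symm_apply_apply] at this
  · have := (key ⟨(φ.symm ⟨q, s' q⟩).1, s _⟩ (φ.symm ⟨q, s' q⟩)).2 rfl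
    rwa [φ.apply_symm_apply] at this
  · change f q = f' (φ ⟨q, s q⟩).1
    rw [← card_fiber_sigma f q, ← card_fiber_sigma f' (φ ⟨q, s q⟩).1]
    exact Nat.card_congr (φ.toEquiv.subtypeEquiv fun x => (key x ⟨q, s q⟩).symm)

end Blow

/-! ### The refinement property -/

theorem thin_zykovProd {V W : Type} {G : SimpleGraph V} {H : SimpleGraph W} (hG : Thin G)
    (hH : Thin H) : Thin (zykovProd G H) := by
  rintro ⟨a, b⟩ ⟨a', b'⟩ h
  have h1 : ∀ c d, G.Adj a c ∨ H.Adj b d ↔ G.Adj a' c ∨ H.Adj b' d := fun c d => h (c, d)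
  have ha := G.loopless.irrefl a
  have hb := H.loopless.irrefl b
  have ha' := G.loopless.irrefl a'
  have hb' := H.loopless.irrefl b'
  refine Prod.ext (hG _ _ fun c => ?_) (hH _ _ fun d => ?_)
  -- Testing at `(a, b)` and `(a', b')` shows that `b` and `b'` are not adjacent, so testing at `(c,
  -- b)` and `(c, b')` isolates `G`.
  · have := h1 c b
    have := h1 c b'
    have := h1 a b
    have := h1 a' b'
    tauto
  · have := h1 a d
    have := h1 a' d
    have := h1 a b
    have := h1 a' b'
    tauto

theorem zykovProd_swap {V W : Type} (G : SimpleGraph V) (H : SimpleGraph W) :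
    ∃ e : zykovProd G H ≃g zykovProd H G, ∀ p, e p = p.swap :=
  ⟨⟨Equiv.prodComm V W, or_comm⟩, fun _ => rfl⟩

/-- The vertex set of `g` is non-empty and the complement of `g` is connected. -/
def IsCoConnected (g : ZykovGraph) : Prop :=
  ∃ (V : Type) (_ : Finite V) (G : SimpleGraph V), g = of G ∧ CoConnected G

theorem isCoConnected_of_iff {V : Type} [Finite V] (G : SimpleGraph V) :
    IsCoConnected (of G) ↔ CoConnected G := by
  refine ⟨?_, fun h => ⟨V, inferInstance, G, rfl, h⟩⟩
  rintro ⟨W, _, H, h, hH⟩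
  obtain ⟨e⟩ := (of_eq_of_iff _ _).1 h
  exact hH.map e.symm e.symm.surjective fun _ _ h h' => h (e.symm.map_rel_iff.1 h')

theorem IsCoConnected.of_mul {a b : ZykovGraph} (h : IsCoConnected (a * b)) :
    IsCoConnected a ∧ IsCoConnected b := by
  induction a using ind with | h V G
  induction b using ind with | h W H
  rw [of_mul_of, isCoConnected_of_iff] at h
  rw [isCoConnected_of_iff, isCoConnected_of_iff]
  exact ⟨h.fst, h.snd⟩

theorem IsCoConnected.base {Q : Type} [Finite Q] {T : SimpleGraph Q} {f : Q → ℕ}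
    (hf : ∀ q, f q ≠ 0) (h : IsCoConnected (blow T f)) : CoConnected T := by
  rw [blow, isCoConnected_of_iff] at h
  exact h.map Sigma.fst (fun q => ⟨⟨q, 0, Nat.pos_of_ne_zero (hf q)⟩, rfl⟩) fun _ _ h h' => h h'

/-- Graphs with connected complement satisfy the refinement property. -/
theorem exists_refinement {a b c d : ZykovGraph} (hab : IsCoConnected (a * b))
    (h : a * b = c * d) :
    ∃ w x y z, a = w * x ∧ b = y * z ∧ c = w * y ∧ d = x * z := by
  obtain ⟨A, _, GA, fA, tA, hA, rfl⟩ := exists_eq_blow a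
  obtain ⟨B, _, GB, fB, tB, hB, rfl⟩ := exists_eq_blow b
  obtain ⟨C, _, GC, fC, tC, hC, rfl⟩ := exists_eq_blow c
  obtain ⟨D, _, GD, fD, tD, hD, rfl⟩ := exists_eq_blow d
  rw [blow_mul_blow] at hab
  have hT := hab.base fun q : A × B => mul_ne_zero (hA q.1) (hB q.2)
  rw [blow_mul_blow, blow_mul_blow] at h
  obtain ⟨γ, hγ⟩ := exists_iso_of_blow_eq (thin_zykovProd tA tB) (thin_zykovProd tC tD)
    (fun q => mul_ne_zero (hA q.1) (hB q.2)) (fun q => mul_ne_zero (hC q.1) (hD q.2)) h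
  obtain ⟨α', hα'⟩ := zykovProd_swap GA GB
  obtain ⟨σ, hσ⟩ := zykovProd_swap GC GD
  let γ' := γ.trans σ
  have hγ' : ∀ q, γ' q = (γ q).swap := fun q => hσ _
  obtain ⟨q₀⟩ := hT.1
  -- The four common factors are the intersections of the `A`- or `B`-layer through `q₀` with the
  -- `C`- or `D`-layer through `q₀`. The swapped maps `α'` and `γ'` let `exists_layer_iso` treat `B`
  -- and `D` as first factors.
  let W : Set (A × B) := {q | q.2 = q₀.2 ∧ (γ q).2 = (γ q₀).2}
  let X : Set (A × B) := {q | q.2 = q₀.2 ∧ (γ q).1 = (γ q₀).1}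
  let Y : Set (A × B) := {q | q.1 = q₀.1 ∧ (γ q).2 = (γ q₀).2}
  let Z : Set (A × B) := {q | q.1 = q₀.1 ∧ (γ q).1 = (γ q₀).1}
  obtain ⟨ΦA, hΦA⟩ := exists_layer_iso hT tB SimpleGraph.Iso.refl γ q₀ W X
    (fun q => Iff.rfl) (fun q => Iff.rfl)
  obtain ⟨ΦB, hΦB⟩ := exists_layer_iso hT tA α' γ q₀ Y Z
    (fun q => by rw [hα', hα']; exact Iff.rfl) (fun q => by rw [hα', hα']; exact Iff.rfl)
  obtain ⟨ΦC, hΦC⟩ := exists_layer_iso hT tD γ SimpleGraph.Iso.refl q₀ W Y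
    (fun q => and_comm) (fun q => and_comm)
  obtain ⟨ΦD, hΦD⟩ := exists_layer_iso hT tC γ' SimpleGraph.Iso.refl q₀ X Z
    (fun q => by rw [hγ', hγ']; exact and_comm) (fun q => by rw [hγ', hγ']; exact and_comm)
  have : Nonempty W := ⟨q₀, rfl, rfl⟩
  have : Nonempty X := ⟨q₀, rfl, rfl⟩
  have : Nonempty Y := ⟨q₀, rfl, rfl⟩
  have : Nonempty Z := ⟨q₀, rfl, rfl⟩
  have : Nonempty A := ⟨q₀.1⟩
  let F : A × B → ℕ := fun q => fA q.1 * fB q.2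
  have e0 := hγ q₀
  -- In the `γ`-coordinates `q₀`, `w`, `x` and the vertex `(ΦA (w, x), q₀.2)` are the corners of a
  -- rectangle, so `F` has equal products over the two diagonals. The constant is what `F` at that
  -- vertex and at `q₀` contributes besides `fA (ΦA (w, x))`.
  have p1 : ∀ (w : W) (x : X),
      fA (ΦA (w, x)) * (fA q₀.1 * (fB q₀.2) ^ 2) = F w * F x := by
    intro w x
    have hp := hγ (ΦA (w, x), q₀.2)
    have e1 : γ (ΦA (w, x), q₀.2) = ((γ w).1, (γ x).2) := hΦA w x
    rw [e1] at hp
    have hw := hγ w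
    have hx := hγ x
    rw [w.2.2] at hw
    rw [x.2.2] at hx
    change fA (ΦA (w, x)) * _ = (fA w.1.1 * fB w.1.2) * (fA x.1.1 * fB x.1.2)
    rw [hw, hx]
    calc _ = (fA (ΦA (w, x)) * fB q₀.2) * (fA q₀.1 * fB q₀.2) := by ring
      _ = _ := by rw [hp, e0]; ring
  have p2 : ∀ (y : Y) (z : Z),
      fB (ΦB (y, z)) * (fB q₀.2 * (fA q₀.1) ^ 2) = F y * F z := by
    intro y z
    have e1 := hΦB y z
    have e2 : α'.symm (ΦB (y, z), (α' q₀).2) = (q₀.1, ΦB (y, z)) := by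
      rw [RelIso.symm_apply_eq, hα', hα']
      rfl
    rw [e2] at e1
    have hp := hγ (q₀.1, ΦB (y, z))
    rw [e1] at hp
    have hy := hγ y
    have hz := hγ z
    rw [y.2.2] at hy
    rw [z.2.2] at hz
    change fB (ΦB (y, z)) * _ = (fA y.1.1 * fB y.1.2) * (fA z.1.1 * fB z.1.2)
    rw [hy, hz]
    calc _ = (fA q₀.1 * fB (ΦB (y, z))) * (fA q₀.1 * fB q₀.2) := by ring
      _ = _ := by rw [hp, e0]; ring
  have p3 : ∀ (w : W) (y : Y),
      fC (ΦC (w, y)) * (fC (γ q₀).1 * (fD (γ q₀).2) ^ 2) = F w * F y := by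
    intro w y
    have e1 : γ.symm (ΦC (w, y), (γ q₀).2) = ((w : A × B).1, (y : A × B).2) := hΦC w y
    have hp := hγ ((w : A × B).1, (y : A × B).2)
    rw [← e1, γ.apply_symm_apply] at hp
    rw [e1] at hp
    change fC (ΦC (w, y)) * _ = (fA w.1.1 * fB w.1.2) * (fA y.1.1 * fB y.1.2)
    rw [w.2.1, y.2.1]
    calc _ = (fC (ΦC (w, y)) * fD (γ q₀).2) * (fC (γ q₀).1 * fD (γ q₀).2) := by ring
      _ = _ := by rw [← hp, ← e0]; ring
  have p4 : ∀ (x : X) (z : Z),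
      fD (ΦD (x, z)) * (fD (γ q₀).2 * (fC (γ q₀).1) ^ 2) = F x * F z := by
    intro x z
    have e1 : γ'.symm (ΦD (x, z), (γ' q₀).2) = ((x : A × B).1, (z : A × B).2) := hΦD x z
    have hp := hγ ((x : A × B).1, (z : A × B).2)
    have e2 : γ ((x : A × B).1, (z : A × B).2) = ((γ q₀).1, ΦD (x, z)) := by
      have h5 := hγ' ((x : A × B).1, (z : A × B).2)
      rw [← e1, γ'.apply_symm_apply, e1, hγ'] at h5
      exact (Prod.swap_injective h5).symm
    rw [e2] at hp
    change fD (ΦD (x, z)) * _ = (fA x.1.1 * fB x.1.2) * (fA z.1.1 * fB z.1.2)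
    rw [x.2.1, z.2.1]
    calc _ = (fC (γ q₀).1 * fD (ΦD (x, z))) * (fC (γ q₀).1 * fD (γ q₀).2) := by ring
      _ = _ := by rw [← hp, ← e0]; ring
  obtain ⟨gW, gX, gY, gZ, h1, h2, h3, h4⟩ := exists_weight_refinement hA γ.toEquiv hγ
    ΦA.toEquiv ΦB.toEquiv ΦC.toEquiv ΦD.toEquiv
    (mul_ne_zero (hA _) (pow_ne_zero _ (hB _))) (mul_ne_zero (hB _) (pow_ne_zero _ (hA _)))
    (mul_ne_zero (hC _) (pow_ne_zero _ (hD _))) (mul_ne_zero (hD _) (pow_ne_zero _ (hC _)))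
    p1 p2 p3 p4
  exact ⟨blow _ gW, blow _ gX, blow _ gY, blow _ gZ,
      by rw [blow_mul_blow]; exact (blow_congr ΦA fun p => (h1 p.1 p.2).symm).symm,
      by rw [blow_mul_blow]; exact (blow_congr ΦB fun p => (h2 p.1 p.2).symm).symm,
      by rw [blow_mul_blow]; exact (blow_congr ΦC fun p => (h3 p.1 p.2).symm).symm,
      by rw [blow_mul_blow]; exact (blow_congr ΦD fun p => (h4 p.1 p.2).symm).symm⟩

end ZykovGraph

/-! ### Unique factorization -/

namespace ZykovGraph

/-- The number of vertices. -/
noncomputable def order (g : ZykovGraph) : ℕ :=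
  Quotient.liftOn g (fun A => Nat.card A.V) fun _ _ ⟨e⟩ => Nat.card_congr e.toEquiv

theorem order_of {V : Type} [Finite V] (G : SimpleGraph V) : order (of G) = Nat.card V := rfl

theorem order_mul (a b : ZykovGraph) : order (a * b) = order a * order b := by
  induction a using ind with | h V G
  induction b using ind with | h W H
  exact Nat.card_prod V W

theorem order_add (a b : ZykovGraph) : order (a + b) = order a + order b := by
  induction a using ind with | h V G
  induction b using ind with | h W H
  exact Nat.card_sum

theorem order_eq_one_iff {g : ZykovGraph} : order g = 1 ↔ g = 1 := by
  refine ⟨fun h => ?_, fun h => by rw [h, one_def, order_of, Nat.card_unique]⟩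
  induction g using ind with | h V G
  rw [order_of, Nat.card_eq_one_iff_unique] at h
  obtain ⟨_, ⟨v⟩⟩ := h
  have : Unique V := ⟨⟨v⟩, fun a => Subsingleton.elim a v⟩
  refine (of_eq_of_iff _ _).2 ⟨⟨Equiv.ofUnique V Unit, fun {a b} => ?_⟩⟩
  rw [Subsingleton.elim a b]
  simp

theorem order_one : order 1 = 1 := order_eq_one_iff.2 rfl

theorem IsCoConnected.order_ne_zero {g : ZykovGraph} (h : IsCoConnected g) : order g ≠ 0 := by
  obtain ⟨V, _, G, rfl, h⟩ := h
  have := h.1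
  exact Nat.card_pos.ne'

theorem eq_one_of_mul_eq_left {a b : ZykovGraph} (ha : order a ≠ 0) (h : a = a * b) : b = 1 := by
  refine order_eq_one_iff.1 (Nat.eq_of_mul_eq_mul_left (Nat.pos_of_ne_zero ha) ?_)
  rw [mul_one, ← order_mul, ← h]

/-- In a refinement with `p = w * x`, primality makes `w` equal to `1` or `p`, so `p` is absorbed by
one side. -/
theorem IsPrimeGraph.dvd_or_dvd {p q a b : ZykovGraph} (hp : IsPrimeGraph p)
    (hc : IsCoConnected (p * q)) (h : p * q = a * b) : p ∣ a ∨ p ∣ b := by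
  obtain ⟨w, x, y, z, rfl, -, rfl, rfl⟩ := exists_refinement hc h
  rcases hp.2 w (Dvd.intro x rfl) with rfl | hw
  · rw [one_mul] at *
    exact Or.inr (dvd_mul_right x z)
  · rw [← hw]
    exact Or.inl (dvd_mul_right w y)

theorem IsPrimeGraph.cancel {p q r : ZykovGraph} (hp : IsPrimeGraph p)
    (hc : IsCoConnected (p * q)) (h : p * q = p * r) : q = r := by
  obtain ⟨w, x, y, z, h1, h2, h3, h4⟩ := exists_refinement hc h
  have hp0 := hc.of_mul.1.order_ne_zero
  rcases hp.2 w (Dvd.intro x h1.symm) with rfl | rfl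
  · rw [one_mul] at h1 h3
    rw [h2, h4, ← h1, ← h3]
  · rw [h2, h4, eq_one_of_mul_eq_left hp0 h1, eq_one_of_mul_eq_left hp0 h3]

theorem IsPrimeGraph.mem_of_dvd_prod {p : ZykovGraph} (hp : IsPrimeGraph p)
    (t : Multiset ZykovGraph) (ht : ∀ q ∈ t, IsPrimeGraph q) (hc : IsCoConnected t.prod)
    (h : p ∣ t.prod) : p ∈ t := by
  induction t using Multiset.induction_on with
  | empty =>
    obtain ⟨q, hq⟩ := h
    rw [Multiset.prod_zero] at hq
    have := congrArg order hq
    rw [order_one, order_mul] at this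
    exact (hp.1 (order_eq_one_iff.1 (Nat.eq_one_of_mul_eq_one_right this.symm))).elim
  | cons a t ih =>
    obtain ⟨q, hq⟩ := h
    rw [Multiset.prod_cons] at hc hq
    rcases hp.dvd_or_dvd (hq ▸ hc) hq.symm with h | h
    · rcases (ht a (Multiset.mem_cons_self a t)).2 p h with h | h
      · exact (hp.1 h).elim
      · rw [h]
        exact Multiset.mem_cons_self a t
    · exact Multiset.mem_cons_of_mem
        (ih (fun q hq => ht q (Multiset.mem_cons_of_mem hq)) hc.of_mul.2 h)

theorem primeFactorization_unique (s t : Multiset ZykovGraph) (hs : ∀ q ∈ s, IsPrimeGraph q)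
    (ht : ∀ q ∈ t, IsPrimeGraph q) (hc : IsCoConnected s.prod) (h : s.prod = t.prod) :
    s = t := by
  induction s using Multiset.induction_on generalizing t with
  | empty =>
    refine (Multiset.eq_zero_of_forall_notMem fun q hq => (ht q hq).1 ?_).symm
    obtain ⟨t, rfl⟩ := Multiset.exists_cons_of_mem hq
    have := congrArg order (Multiset.prod_cons q t)
    rw [← h, Multiset.prod_zero, order_one, order_mul] at this
    exact order_eq_one_iff.1 (Nat.eq_one_of_mul_eq_one_right this.symm)
  | cons p s ih =>
    have hp := hs p (Multiset.mem_cons_self p s)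
    have hmem : p ∈ t := hp.mem_of_dvd_prod t ht (h ▸ hc) (by
      rw [← h, Multiset.prod_cons]
      exact dvd_mul_right p _)
    obtain ⟨t, rfl⟩ := Multiset.exists_cons_of_mem hmem
    rw [Multiset.prod_cons, Multiset.prod_cons] at h
    rw [Multiset.prod_cons] at hc
    rw [ih t (fun q hq => hs q (Multiset.mem_cons_of_mem hq))
      (fun q hq => ht q (Multiset.mem_cons_of_mem hq)) hc.of_mul.2 (hp.cancel hc h)]

/-- Proper divisors of a non-empty graph have fewer vertices. The empty graph must be excluded: a
product equal to it has an empty factor, which is not prime. -/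
theorem exists_primeFactorization (n : ℕ) (g : ZykovGraph) (hn : order g = n) (h0 : n ≠ 0) :
    ∃ s, IsPrimeFactorization s g := by
  induction n using Nat.strong_induction_on generalizing g with
  | _ n ih =>
    by_cases h1 : g = 1
    · exact ⟨0, by simp, by simp [h1]⟩
    by_cases hg : IsPrimeGraph g
    · exact ⟨{g}, by simpa using hg, by simp⟩
    · have : ∃ d, d ∣ g ∧ d ≠ 1 ∧ d ≠ g := by
        by_contra! hcon
        exact hg ⟨h1, fun d hd => or_iff_not_imp_left.2 (hcon d hd)⟩
      obtain ⟨a, ⟨b, rfl⟩, ha1, hab⟩ := this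
      have hb1 : b ≠ 1 := fun h => hab (by rw [h, mul_one])
      rw [order_mul] at hn
      have ha2 : order a ≠ 1 := fun h => ha1 (order_eq_one_iff.1 h)
      have hb2 : order b ≠ 1 := fun h => hb1 (order_eq_one_iff.1 h)
      have ha0 : order a ≠ 0 := fun h => h0 (by rw [← hn, h, zero_mul])
      have hb0 : order b ≠ 0 := fun h => h0 (by rw [← hn, h, mul_zero])
      obtain ⟨s, hs, hsa⟩ := ih (order a)
        (by rw [← hn]; exact lt_mul_of_one_lt_right (by omega) (by omega)) a rfl ha0
      obtain ⟨t, ht, htb⟩ := ih (order b)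
        (by rw [← hn]; exact lt_mul_of_one_lt_left (by omega) (by omega)) b rfl hb0
      refine ⟨s + t, fun p hp => (Multiset.mem_add.1 hp).elim (hs p) (ht p), ?_⟩
      rw [Multiset.prod_add, hsa, htb]

theorem isCoConnected_of_compl_connected {V : Type} [Finite V] {G : SimpleGraph V}
    (h : Gᶜ.Connected) : IsCoConnected (of G) := by
  refine (isCoConnected_of_iff G).2 ⟨h.nonempty, fun x y => ?_⟩
  exact ((SimpleGraph.reachable_iff_reflTransGen x y).1 (h.preconnected x y)).lift id
    fun a b hab => ((SimpleGraph.compl_adj _ _ _).1 hab).2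

theorem existsUnique_primeFactorization {g : ZykovGraph} (h : IsCoConnected g) :
    ∃! s : Multiset ZykovGraph, IsPrimeFactorization s g := by
  obtain ⟨s, hs⟩ := exists_primeFactorization _ g rfl h.order_ne_zero
  refine ⟨s, hs, fun t ht => primeFactorization_unique t s ht.1 hs.1 ?_ (ht.2.trans hs.2.symm)⟩
  rwa [ht.2]

/-! ### Complete multipartite graphs with a singleton class -/

theorem thin_top (V : Type) : Thin (⊤ : SimpleGraph V) := fun x y h => by
  simpa using h y

theorem blow_eq_one {Q : Type} [Finite Q] (T : SimpleGraph Q) {g : Q → ℕ} {q : Q}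
    (hQ : Nat.card Q = 1) (hq : g q = 1) : blow T g = 1 := by
  have hs := (Nat.card_eq_one_iff_unique.1 hQ).1
  have : Unique Q := ⟨⟨q⟩, fun a => Subsingleton.elim a q⟩
  rw [← order_eq_one_iff, blow, order_of, Nat.card_congr (Equiv.uniqueSigma _), Nat.card_fin,
    Subsingleton.elim default q, hq]

/-- A factorization splits the base, so the numbers of base vertices multiply to the prime `n` and
one factor has a one-point base. The singleton class forces the weight of that point to be `1`, so
this factor is trivial. -/
theorem isPrimeGraph_blow_top {n : ℕ} (hn : n.Prime) {f : Fin n → ℕ} (hf : ∀ i, f i ≠ 0)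
    {i : Fin n} (hi : f i = 1) : IsPrimeGraph (blow ⊤ f) := by
  refine ⟨fun h => ?_, ?_⟩
  · have hs : Function.Surjective (Sigma.fst : (Σ j, Fin (f j)) → Fin n) :=
      fun j => ⟨⟨j, 0, Nat.pos_of_ne_zero (hf j)⟩, rfl⟩
    have h1 := Nat.card_le_card_of_surjective _ hs
    rw [← order_eq_one_iff, blow, order_of] at h
    rw [h, Nat.card_fin] at h1
    exact absurd hn.two_le (by omega)
  · rintro a ⟨b, hab⟩
    obtain ⟨Q, _, T, g, tT, hg, rfl⟩ := exists_eq_blow a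
    obtain ⟨Q', _, T', g', tT', hg', rfl⟩ := exists_eq_blow b
    obtain ⟨e, he⟩ := exists_iso_of_blow_eq (thin_top _) (thin_zykovProd tT tT') hf
      (fun q => mul_ne_zero (hg q.1) (hg' q.2)) (hab.trans (blow_mul_blow g g'))
    have hcard := Nat.card_congr e.toEquiv
    rw [Nat.card_prod, Nat.card_fin] at hcard
    have hei := (he i).symm.trans hi
    rcases hn.eq_one_or_self_of_dvd _ (Dvd.intro _ hcard.symm) with h | h
    · exact Or.inl (blow_eq_one T h (Nat.eq_one_of_mul_eq_one_right hei))
    · right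
      rw [h] at hcard
      have h' : Nat.card Q' = 1 :=
        (Nat.eq_of_mul_eq_mul_left hn.pos ((mul_one n).trans hcard)).symm
      rw [hab, blow_eq_one T' h' (Nat.eq_one_of_mul_eq_one_left hei), mul_one]

theorem isPrimeGraph_comap_top {V : Type} [Finite V] {n : ℕ} (hn : n.Prime) (π : V → Fin n)
    (hπ : Function.Surjective π) {i : Fin n} (hi : ∃! v, π v = i) :
    IsPrimeGraph (of ((⊤ : SimpleGraph (Fin n)).comap π)) := by
  rw [of_comap_eq_blow]
  refine isPrimeGraph_blow_top hn (fun j => ?_) (i := i) ?_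
  · obtain ⟨v, hv⟩ := hπ j
    have : Nonempty {v // π v = j} := ⟨v, hv⟩
    exact Nat.card_pos.ne'
  · obtain ⟨v, hv, huniq⟩ := hi
    exact Nat.card_eq_one_iff_exists.2 ⟨⟨v, hv⟩, fun w => Subtype.ext (huniq w w.2)⟩

theorem isPrimeGraph_one_add_pointGraph {m : ℕ} (hm : m ≠ 0) :
    IsPrimeGraph (1 + pointGraph m) := by
  have h : zykovJoin (⊥ : SimpleGraph Unit) (⊥ : SimpleGraph (Fin m)) =
      (⊤ : SimpleGraph (Fin 2)).comap (Sum.elim (fun _ => 0) fun _ => 1) := by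
    ext (a | a) (b | b) <;> simp [zykovJoin]
  rw [one_def, pointGraph, of_add_of, h]
  refine isPrimeGraph_comap_top Nat.prime_two _ (fun j => ?_) (i := 0)
    ⟨Sum.inl (), rfl, by rintro (a | a) h <;> simp_all⟩
  fin_cases j
  · exact ⟨Sum.inl (), rfl⟩
  · exact ⟨Sum.inr ⟨0, Nat.pos_of_ne_zero hm⟩, rfl⟩

theorem isPrimeGraph_one_add_pointGraph_add_pointGraph {l m : ℕ} (hl : l ≠ 0) (hm : m ≠ 0) :
    IsPrimeGraph (1 + pointGraph l + pointGraph m) := by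
  have h : zykovJoin (zykovJoin (⊥ : SimpleGraph Unit) (⊥ : SimpleGraph (Fin l)))
      (⊥ : SimpleGraph (Fin m)) =
      (⊤ : SimpleGraph (Fin 3)).comap
        (Sum.elim (Sum.elim (fun _ => 0) fun _ => 1) fun _ => 2) := by
    ext ((a | a) | a) ((b | b) | b) <;> simp [zykovJoin]
  rw [one_def, pointGraph, pointGraph, of_add_of, of_add_of, h]
  refine isPrimeGraph_comap_top Nat.prime_three _ (fun j => ?_) (i := 0)
    ⟨Sum.inl (Sum.inl ()), rfl, by rintro ((a | a) | a) h <;> simp_all⟩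
  fin_cases j
  · exact ⟨Sum.inl (Sum.inl ()), rfl⟩
  · exact ⟨Sum.inl (Sum.inr ⟨0, Nat.pos_of_ne_zero hl⟩), rfl⟩
  · exact ⟨Sum.inr ⟨0, Nat.pos_of_ne_zero hm⟩, rfl⟩

theorem pointGraph_mul_pointGraph (m n : ℕ) :
    pointGraph m * pointGraph n = pointGraph (m * n) :=
  (of_eq_of_iff _ _).2 ⟨⟨finProdFinEquiv, by simp [zykovProd]⟩⟩

theorem pointGraph_pow (m k : ℕ) : pointGraph m ^ k = pointGraph (m ^ k) := by
  induction k with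
  | zero =>
    rw [pow_zero, pow_zero, eq_comm, ← order_eq_one_iff]
    exact Nat.card_fin 1
  | succ k ih => rw [pow_succ, ih, pointGraph_mul_pointGraph, pow_succ]

theorem order_pointGraph (n : ℕ) : order (pointGraph n) = n := Nat.card_fin n

theorem nonunique_factorization (x : ZykovGraph) (hx : x = pointGraph 2) :
    (1 + x + x ^ 2) * (1 + x ^ 3) = (1 + x ^ 2 + x ^ 4) * (1 + x) ∧
      IsPrimeFactorization {1 + x + x ^ 2, 1 + x ^ 3} ((1 + x + x ^ 2) * (1 + x ^ 3)) ∧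
      IsPrimeFactorization {1 + x ^ 2 + x ^ 4, 1 + x} ((1 + x + x ^ 2) * (1 + x ^ 3)) ∧
      ({1 + x + x ^ 2, 1 + x ^ 3} : Multiset ZykovGraph) ≠ {1 + x ^ 2 + x ^ 4, 1 + x} := by
  have heq : (1 + x + x ^ 2) * (1 + x ^ 3) = (1 + x ^ 2 + x ^ 4) * (1 + x) := by ring
  refine ⟨heq, ⟨?_, Multiset.prod_pair _ _⟩, ⟨?_, (Multiset.prod_pair _ _).trans heq.symm⟩,
    fun h => ?_⟩
  · subst hx
    simp only [Multiset.insert_eq_cons, Multiset.mem_cons, Multiset.mem_singleton]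
    rintro p (rfl | rfl) <;> rw [pointGraph_pow]
    · exact isPrimeGraph_one_add_pointGraph_add_pointGraph two_ne_zero (by norm_num)
    · exact isPrimeGraph_one_add_pointGraph (by norm_num)
  · subst hx
    simp only [Multiset.insert_eq_cons, Multiset.mem_cons, Multiset.mem_singleton]
    rintro p (rfl | rfl)
    · rw [pointGraph_pow, pointGraph_pow]
      exact isPrimeGraph_one_add_pointGraph_add_pointGraph (by norm_num) (by norm_num)
    · exact isPrimeGraph_one_add_pointGraph two_ne_zero
  -- Vertex counts separate the multisets: `1 + x` has 3 vertices, the two factors on the other side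
  -- have 7 and 9.
  · have hmem : 1 + x ∈ ({1 + x + x ^ 2, 1 + x ^ 3} : Multiset ZykovGraph) := by
      rw [h]
      simp
    simp only [Multiset.insert_eq_cons, Multiset.mem_cons, Multiset.mem_singleton] at hmem
    subst hx
    rcases hmem with h | h <;>
    · have := congrArg order h
      simp only [pointGraph_pow, order_add, order_pointGraph, order_one] at this
      omega

end ZykovGraph

open ZykovGraph in
theorem mainTheorem6 :
    -- some non-empty graph has two different prime factorizations
    (∃ (g : ZykovGraph) (s t : Multiset ZykovGraph), g ≠ 0 ∧
      IsPrimeFactorization s g ∧ IsPrimeFactorization t g ∧ s ≠ t) ∧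
    -- an explicit one, from `(1 + x + x ^ 2) * (1 + x ^ 3) = (1 + x ^ 2 + x ^ 4) * (1 + x)`
    (∀ x : ZykovGraph, x = pointGraph 2 →
      (1 + x + x ^ 2) * (1 + x ^ 3) = (1 + x ^ 2 + x ^ 4) * (1 + x) ∧
      IsPrimeFactorization {1 + x + x ^ 2, 1 + x ^ 3} ((1 + x + x ^ 2) * (1 + x ^ 3)) ∧
      IsPrimeFactorization {1 + x ^ 2 + x ^ 4, 1 + x} ((1 + x + x ^ 2) * (1 + x ^ 3)) ∧
      ({1 + x + x ^ 2, 1 + x ^ 3} : Multiset ZykovGraph) ≠ {1 + x ^ 2 + x ^ 4, 1 + x}) ∧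
    -- graphs with connected complement have a unique prime factorization
    (∀ (V : Type) [Finite V] (G : SimpleGraph V), Gᶜ.Connected →
      ∃! s : Multiset ZykovGraph, IsPrimeFactorization s (of G)) := by
  refine ⟨?_, nonunique_factorization, fun V _ G h =>
    existsUnique_primeFactorization (isCoConnected_of_compl_connected h)⟩
  obtain ⟨-, h1, h2, h3⟩ := nonunique_factorization _ rfl
  refine ⟨_, _, _, fun h0 => ?_, h1, h2, h3⟩
  have := congrArg order h0
  rw [zero_def, order_of, Nat.card_of_isEmpty, order_mul, order_add, order_add, order_add,
    order_one] at this
  simp at this
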